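/- For complex $a,b,c,e,f$ let $${}_3F_2(a,b,c;\,e,f\mid 1)=\sum_{k\ge 0}\frac{(a)_k(b)_k(c)_k}{(e)_k(f)_k\,k!},$$ with $(x)_k=x(x+1)\cdots(x+k-1)$, where $e,f$ are not non-positive integers. The series converges absolutely when the excess $s=e+f-a-b-c$ has positive real part; for other $s\notin\{0,-1,-2,\dots\}$ the symbol denotes the analytic continuation in the parameters. Let $n\ge 1$ be an integer and $a,b\in\mathbb C$. Then each of the following seven identities holds whenever the denominators in its parameters are nonzero, the lower parameters of the ${}_3F_2$ are not non-positive integers, no $\Gamma$ in the numerator of the right-hand side is at a pole, and no factor other than a $\Gamma$ in the denominator of the right-hand side vanishes ($1/\Gamma$ is read as $0$ at the poles of $\Gamma$). 1. (excess $2$; here the series itself converges) $${}_3F_2\Big(a,b,-n+\tfrac{an}{b+n};\;1+b+\tfrac{an}{b+n},\,a-n+1\,\Big|\,1\Big)=\frac{(-1)^n\sin(\pi b)\,\Gamma\big(1+b+\frac{an}{b+n}\big)\Gamma(-b)}{\sin(\pi a)\,\Gamma(1+a)\,\Gamma\big(1-n+\frac{an}{b+n}\big)\,\Gamma(n-a)}.$$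 2. (excess $2$; here the series itself converges) $${}_3F_2\Big(a,b,-\tfrac{n(n-b+a)}{b-n};\;1+b-\tfrac{an}{b-n},\,1+a+n\,\Big|\,1\Big)=\frac{(-1)^n\sin(\pi b)\,\Gamma\big(1+b+\frac{an}{n-b}\big)\Gamma(-b)}{\sin(\pi a)\,\Gamma(1+a)\,\Gamma(-a-n)\,\Gamma\big(n+1+\frac{an}{n-b}\big)}.$$ 3. (excess $\frac{n+2-2a+ab-b}{n+1-a}$) $${}_3F_2\Big(a,b,a-n-1;\;a-\tfrac{n(b-1)}{a-n-1},\,a-n+1\,\Big|\,1\Big)=\frac{\sin\!\big(\pi\big(b-a+\frac{n(1-b)}{n+1-a}\big)\big)(n-a)(bn-a+1)\,\Gamma\big(a+\frac{n(b-1)}{n+1-a}\big)\Gamma\big(2-a+\frac{(1-a)(b-1)}{n+1-a}\big)\Gamma\big(2-b+\frac{n(b-1)}{n+1-a}\big)}{(b-a+n)(a-1)\,\pi\,\Gamma\big(2+\frac{n(b-1)}{n+1-a}\big)}.$$ 4. (excess $n+1$; here the series itself converges) $${}_3F_2\Big(a,b,-\tfrac{(a-1)(b-1)}{n};\;2+\tfrac{(b-1)(1-a)}{n},\,-1+a+b+n\,\Big|\,1\Big)=\frac{\sin(\pi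 a)(-1)^n(n-ab+a+b-1)\,\Gamma(n)\,\Gamma(-a-n+1)\,\Gamma(-1+a+b+n)}{\pi\,\Gamma(b+n)}.$$ 5. (excess $2-b+\frac{n(1-b)}{1+a-b}$) $${}_3F_2\Big(a,b,1+a+\tfrac{an}{1+a-b};\;2+a,\,1+a+n\,\Big|\,1\Big)=-\frac{\sin\!\big(\frac{\pi na}{1+a-b}\big)(1+a)\,\Gamma\big(2-b-\frac{n(1-b)}{b-a-1}\big)\Gamma\big(\frac{n(b-1)}{1+a-b}\big)}{\sin(\pi a)\,\Gamma(-b+a+2+n)\,\Gamma(-a-n)}.$$ 6. (excess $\frac{2a+n-2-ab+b}{a+n-1}$) $${}_3F_2\Big(a,b,a+n-1;\;a-1+\tfrac{bn+a-1}{a+n-1},\,1+a+n\,\Big|\,1\Big)=-\frac{\sin\!\big(\pi\big(a+\frac{(1-b)(a-1)}{a+n-1}\big)\big)(bn+a-1)(a+n)\,\Gamma\big(1+\frac{(b-1)(1-a)}{a+n-1}\big)\Gamma\big(a+\frac{n(b-1)}{a+n-1}\big)\Gamma\big(2-a+\frac{(b-1)(a-1)}{a+n-1}\big)}{(n-b+a)\,\pi\,(a-1)\,\Gamma\big(\frac{bn+a-1}{a+n-1}+1\big)}.$$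 7. (excess $2-b+\frac{n(b-1)}{1+a-b}$) $${}_3F_2\Big(a,b,1+a-\tfrac{an}{1+a-b};\;2+a,\,a-n+1\,\Big|\,1\Big)=\frac{(1+a)\sin\!\big(\frac{\pi an}{1+a-b}\big)\,\Gamma\big(2-b+\frac{n(b-1)}{1+a-b}\big)\Gamma\big(-\frac{n(b-1)}{1+a-b}\big)}{\sin(\pi a)\,\Gamma(-b+a+2-n)\,\Gamma(n-a)}.$$ -/

import Mathlib

/-- The `k`-th term `(a)_k (b)_k (c)_k / ((e)_k (f)_k k!)` of the hypergeometric series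
`₃F₂(a, b, c; e, f | 1)`. -/
noncomputable def hyp3F2Term (a b c e f : ℂ) (k : ℕ) : ℂ :=
  ((ascPochhammer ℂ k).eval a * (ascPochhammer ℂ k).eval b * (ascPochhammer ℂ k).eval c) /
    ((ascPochhammer ℂ k).eval e * (ascPochhammer ℂ k).eval f * (k.factorial : ℂ))

/-- `z` is a pole of `Γ`, that is, a non-positive integer. -/
def IsGammaPole (z : ℂ) : Prop := ∃ k : ℕ, z = -(k : ℂ)

/-- The set of the values `z` of the last lower parameter at which `₃F₂(a, b, c; e, z | 1)` is
regular: neither `z` nor the parametric excess `e + z - a - b - c` is a non-positive integer.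
It is the complement of a closed discrete set, hence open and connected, and it meets the
half-plane `0 < re (e + z - a - b - c)` in which the series converges. -/
def hyp3F2Domain (a b c e : ℂ) : Set ℂ :=
  {z | ¬ IsGammaPole z ∧ ¬ IsGammaPole (e + z - a - b - c)}

/-- `v` is the value of `₃F₂(a, b, c; e, f | 1)`, understood as the sum of the series where the
parametric excess has positive real part, and by analytic continuation elsewhere.
The continuation is along the last lower parameter; it is unique, because the domain is connected,
and it is the restriction of the continuation in all five parameters, so that the choice of the
parameter does not matter. If `0 < re (e + f - a - b - c)`, then `v` is the sum of the series. -/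
def Hyp3F2AtOneEq (a b c e f v : ℂ) : Prop :=
  ¬ IsGammaPole e ∧ f ∈ hyp3F2Domain a b c e ∧
    ∃ F : ℂ → ℂ, DifferentiableOn ℂ F (hyp3F2Domain a b c e) ∧
      (∀ z ∈ hyp3F2Domain a b c e, 0 < (e + z - a - b - c).re →
        HasSum (hyp3F2Term a b c e z) (F z)) ∧
      F f = v

/-! Two summations carry all seven identities.

The two identities of excess 2 satisfy ab + bc + ca = (e - 1)(f - 1). Under this condition every
partial sum is a single quotient of Pochhammer symbols (`sum_range_hyp3F2Term`), and Euler's limit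
for Γ turns it into a quotient of Gammas (`hasSum_hyp3F2Term_of_excess_eq_two`).

In the other five, a lower parameter exceeds an upper one by 2. A telescoping relation
(`hasSum_hyp3F2Term_add_two`) writes ₃F₂(a, b, c; c + 2, z) as a Gauss sum minus a multiple of
₃F₂(a, b, c + 1; c + 2, z + 1). The multiplier is ((a - 1)(b - 1) - c(a + b - 1 - z))/z, which the
special parameters make zero (`hyp3F2AtOneEq_add_two`). Continuation still needs the relation for
all z, so the second series is continued to the left by unit steps in z
(`exists_continuation_hyp3F2_unit_shift`).

The stated forms then follow from the reflection formula. Except for the identity of excess n + 1,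
they come in pairs exchanged by n ↦ -n, hence the parameter m = ± n. -/

section Hyp3F2

open Filter Topology

/-! ### Asymptotics of the terms of the series -/

theorem add_natCast_ne_zero {z : ℂ} (hz : ¬ IsGammaPole z) (k : ℕ) : z + k ≠ 0 :=
  fun h => hz ⟨k, eq_neg_of_add_eq_zero_left h⟩

theorem ne_zero_of_not_isGammaPole {z : ℂ} (hz : ¬ IsGammaPole z) : z ≠ 0 := by
  simpa using add_natCast_ne_zero hz 0

theorem not_isGammaPole_add_natCast {z : ℂ} (hz : ¬ IsGammaPole z) (m : ℕ) :
    ¬ IsGammaPole (z + m) := by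
  rintro ⟨k, hk⟩
  exact hz ⟨k + m, by push_cast; linear_combination hk⟩

theorem not_isGammaPole_add_one {z : ℂ} (hz : ¬ IsGammaPole z) : ¬ IsGammaPole (z + 1) := by
  simpa using not_isGammaPole_add_natCast hz 1

theorem not_isGammaPole_of_re_pos {z : ℂ} (hz : 0 < z.re) : ¬ IsGammaPole z := by
  rintro ⟨k, rfl⟩
  simp only [Complex.neg_re, Complex.natCast_re, Left.neg_pos_iff] at hz
  exact absurd hz (not_lt.2 k.cast_nonneg)

theorem not_isGammaPole_one : ¬ IsGammaPole 1 := not_isGammaPole_of_re_pos (by simp)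

theorem Gamma_ne_zero_of_not_isGammaPole {z : ℂ} (hz : ¬ IsGammaPole z) : Complex.Gamma z ≠ 0 :=
  fun h => hz ((Complex.Gamma_eq_zero_iff z).1 h)

theorem ascPochhammer_eval_ne_zero {z : ℂ} (hz : ¬ IsGammaPole z) (k : ℕ) :
    (ascPochhammer ℂ k).eval z ≠ 0 := by
  rw [Ne, ascPochhammer_eval_eq_zero_iff]
  rintro ⟨m, -, hm⟩
  exact hz ⟨m, by rw [hm, neg_neg]⟩

theorem ascPochhammer_eval_eq_prod (z : ℂ) (k : ℕ) :
    (ascPochhammer ℂ k).eval z = ∏ j ∈ Finset.range k, (z + j) := by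
  induction k with
  | zero => simp
  | succ k ih => rw [ascPochhammer_succ_eval, Finset.prod_range_succ, ih]

theorem mul_ascPochhammer_eval_add_one (z : ℂ) (k : ℕ) :
    z * (ascPochhammer ℂ k).eval (z + 1) = (ascPochhammer ℂ k).eval z * (z + k) := by
  rw [← ascPochhammer_succ_eval, ascPochhammer_eval_eq_prod, ascPochhammer_eval_eq_prod,
    Finset.prod_range_succ', mul_comm]
  simp [add_assoc, add_comm (1 : ℂ)]

/-- Euler's limit, inverted so that poles are allowed: there `Complex.Gamma` and its inverse are 0
and (z)_{n+1} is eventually 0. Euler's product has n + 1 factors, hence the index shift. -/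
theorem tendsto_ascPochhammer_eval_div (z : ℂ) :
    Tendsto (fun n : ℕ => (ascPochhammer ℂ (n + 1)).eval z / ((n : ℂ) ^ z * n.factorial)) atTop
      (𝓝 (Complex.Gamma z)⁻¹) := by
  have h : (fun n : ℕ => (ascPochhammer ℂ (n + 1)).eval z / ((n : ℂ) ^ z * n.factorial)) =
      fun n => (Complex.GammaSeq z n)⁻¹ := by
    funext n
    rw [Complex.GammaSeq, inv_div, ascPochhammer_eval_eq_prod]
  by_cases hz : Complex.Gamma z = 0
  · obtain ⟨m, hm⟩ := (Complex.Gamma_eq_zero_iff z).1 hz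
    rw [hz, inv_zero]
    refine tendsto_const_nhds.congr' ?_
    filter_upwards [eventually_ge_atTop m] with n hn
    rw [(ascPochhammer_eval_eq_zero_iff _ _).2 ⟨m, by omega, by rw [hm, neg_neg]⟩, zero_div]
  · rw [h]
    exact (Complex.GammaSeq_tendsto_Gamma z).inv₀ hz

theorem tendsto_cpow_mul_hyp3F2Term {a b c e f : ℂ} (he : ¬ IsGammaPole e)
    (hf : ¬ IsGammaPole f) :
    Tendsto (fun n : ℕ => (n : ℂ) ^ (e + f - a - b - c + 1) * hyp3F2Term a b c e f (n + 1)) atTop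
      (𝓝 (Complex.Gamma e * Complex.Gamma f /
        (Complex.Gamma a * Complex.Gamma b * Complex.Gamma c))) := by
  have key := (((tendsto_ascPochhammer_eval_div a).mul (tendsto_ascPochhammer_eval_div b)).mul
    (tendsto_ascPochhammer_eval_div c)).div
    (((tendsto_ascPochhammer_eval_div e).mul (tendsto_ascPochhammer_eval_div f)).mul
      (tendsto_ascPochhammer_eval_div 1))
    (by simp [Gamma_ne_zero_of_not_isGammaPole he, Gamma_ne_zero_of_not_isGammaPole hf])
  refine (key.congr' ?_).trans_eq ?_
  · filter_upwards [eventually_gt_atTop 0] with n hn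
    have hn' : (n : ℂ) ≠ 0 := by exact_mod_cast hn.ne'
    have h0 : ((n.factorial : ℕ) : ℂ) ≠ 0 := by exact_mod_cast n.factorial_ne_zero
    have h1 : (((n + 1).factorial : ℕ) : ℂ) ≠ 0 := by exact_mod_cast (n + 1).factorial_ne_zero
    have hpow : (n : ℂ) ^ (e + f - a - b - c + 1) =
        (n : ℂ) ^ e * (n : ℂ) ^ f * n / ((n : ℂ) ^ a * (n : ℂ) ^ b * (n : ℂ) ^ c) := by
      rw [Complex.cpow_add _ _ hn', Complex.cpow_sub _ _ hn', Complex.cpow_sub _ _ hn',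
        Complex.cpow_sub _ _ hn', Complex.cpow_add _ _ hn', Complex.cpow_one]
      field_simp
    have hz (z : ℂ) : (n : ℂ) ^ z ≠ 0 := by simp [Complex.cpow_eq_zero_iff, hn']
    have ha := hz a
    have hb := hz b
    have hc := hz c
    have he' := hz e
    have hf' := hz f
    have hpe := ascPochhammer_eval_ne_zero he (n + 1)
    have hpf := ascPochhammer_eval_ne_zero hf (n + 1)
    rw [hpow, hyp3F2Term]
    simp only [Pi.div_apply, ascPochhammer_eval_one, Complex.cpow_one]
    field_simp
  · simp only [Complex.Gamma_one]
    congr 1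
    rw [inv_one, mul_one, ← mul_inv, ← mul_inv, ← mul_inv, div_eq_mul_inv, inv_inv, mul_comm,
      ← div_eq_mul_inv]

theorem isBigO_hyp3F2Term {a b c e f : ℂ} (he : ¬ IsGammaPole e) (hf : ¬ IsGammaPole f) :
    (fun n : ℕ => hyp3F2Term a b c e f (n + 1)) =O[atTop]
      fun n : ℕ => (n : ℝ) ^ (-((e + f - a - b - c).re + 1)) := by
  have h := (tendsto_cpow_mul_hyp3F2Term (a := a) (b := b) (c := c) he hf).isBigO_one ℂ
  have h2 := (Asymptotics.isBigO_refl
    (fun n : ℕ => (n : ℂ) ^ (-(e + f - a - b - c + 1))) atTop).mul h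
  refine (h2.congr' ?_ EventuallyEq.rfl).trans ?_
  · filter_upwards [eventually_gt_atTop 0] with n hn
    have hn' : (n : ℂ) ≠ 0 := by exact_mod_cast hn.ne'
    rw [← mul_assoc, ← Complex.cpow_add _ _ hn', neg_add_cancel, Complex.cpow_zero, one_mul]
  · refine Asymptotics.IsBigO.of_bound 1 ?_
    filter_upwards [eventually_gt_atTop 0] with n hn
    rw [mul_one, one_mul, Complex.norm_natCast_cpow_of_pos hn, Real.norm_of_nonneg (by positivity)]
    simp

theorem tendsto_hyp3F2Term_zero {a b c e f : ℂ} (he : ¬ IsGammaPole e) (hf : ¬ IsGammaPole f)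
    (hs : -1 < (e + f - a - b - c).re) :
    Tendsto (hyp3F2Term a b c e f) atTop (𝓝 0) := by
  rw [← tendsto_add_atTop_iff_nat 1]
  refine (isBigO_hyp3F2Term he hf).trans_tendsto ?_
  exact (tendsto_rpow_neg_atTop (by linarith)).comp tendsto_natCast_atTop_atTop

theorem summable_hyp3F2Term {a b c e f : ℂ} (he : ¬ IsGammaPole e) (hf : ¬ IsGammaPole f)
    (hs : 0 < (e + f - a - b - c).re) : Summable (hyp3F2Term a b c e f) := by
  rw [← summable_nat_add_iff 1]
  exact summable_of_isBigO_nat (Real.summable_nat_rpow.2 (by linarith)) (isBigO_hyp3F2Term he hf)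

theorem hyp3F2Term_zero (a b c e f : ℂ) : hyp3F2Term a b c e f 0 = 1 := by
  simp [hyp3F2Term]

theorem hyp3F2Term_succ (a b c e f : ℂ) (k : ℕ) :
    hyp3F2Term a b c e f (k + 1) = hyp3F2Term a b c e f k *
      ((a + k) * (b + k) * (c + k) / ((e + k) * (f + k) * (k + 1))) := by
  simp only [hyp3F2Term, ascPochhammer_succ_eval, Nat.factorial_succ, Nat.cast_mul, Nat.cast_add,
    Nat.cast_one]
  rw [div_mul_div_comm]
  congr 1 <;> ring

/-- A telescoping series. -/
theorem hasSum_of_telescoping {t u H : ℕ → ℂ} {S : ℂ} (ht : Summable t) (hu : HasSum u S)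
    (hH : Tendsto H atTop (𝓝 0)) (h0 : t 0 = u 0 + H 0)
    (hsucc : ∀ k, t (k + 1) = u (k + 1) + (H (k + 1) - H k)) : HasSum t S := by
  have hsum (m : ℕ) : ∑ k ∈ Finset.range (m + 1), t k =
      ∑ k ∈ Finset.range (m + 1), u k + H m := by
    induction m with
    | zero => simpa using h0
    | succ m ih => rw [Finset.sum_range_succ, ih, Finset.sum_range_succ _ (m + 1), hsucc]; ring
  have h1 := (hu.tendsto_sum_nat.comp (tendsto_add_atTop_nat 1)).add hH
  rw [add_zero] at h1
  have h2 := ht.hasSum.tendsto_sum_nat.comp (tendsto_add_atTop_nat 1)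
  have h3 : ∑' k, t k = S := tendsto_nhds_unique h2 (h1.congr fun m => (hsum m).symm)
  exact h3 ▸ ht.hasSum

/-! ### Series of excess two -/

/-- With X = m + 1, the induction step is X(X + e - 1)(X + f - 1) + abc = (X + a)(X + b)(X + c). The
two hypotheses match the coefficients of X² and X. -/
theorem sum_range_hyp3F2Term {a b c e f : ℂ} (he : ¬ IsGammaPole e) (hf : ¬ IsGammaPole f)
    (h1 : e + f - a - b - c = 2) (h2 : a * b + b * c + c * a = (e - 1) * (f - 1)) (m : ℕ) :
    ∑ k ∈ Finset.range (m + 1), hyp3F2Term a b c e f k =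
      hyp3F2Term (a + 1) (b + 1) (c + 1) e f m := by
  have hfac (k : ℕ) : hyp3F2Term (a + 1) (b + 1) (c + 1) e f k * (a * b * c) =
      hyp3F2Term a b c e f k * ((a + k) * (b + k) * (c + k)) := by
    rw [hyp3F2Term, hyp3F2Term, div_mul_eq_mul_div, div_mul_eq_mul_div]
    congr 1
    calc _ = (a * (ascPochhammer ℂ k).eval (a + 1)) * (b * (ascPochhammer ℂ k).eval (b + 1)) *
          (c * (ascPochhammer ℂ k).eval (c + 1)) := by ring
      _ = _ := by simp only [mul_ascPochhammer_eval_add_one]; ring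
  induction m with
  | zero => simp [hyp3F2Term_zero]
  | succ m ih =>
    have he' := add_natCast_ne_zero he m
    have hf' := add_natCast_ne_zero hf m
    have hm : (m : ℂ) + 1 ≠ 0 := by exact_mod_cast m.succ_ne_zero
    rw [Finset.sum_range_succ, ih, hyp3F2Term_succ, hyp3F2Term_succ, ← mul_div_assoc, ← hfac]
    field_simp
    linear_combination (hyp3F2Term (a + 1) (b + 1) (c + 1) e f m) *
      (((m : ℂ) + 1) ^ 2 * h1 - (m + 1) * h2)

theorem hasSum_hyp3F2Term_of_excess_eq_two {a b c e f : ℂ} (he : ¬ IsGammaPole e)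
    (hf : ¬ IsGammaPole f) (h1 : e + f - a - b - c = 2)
    (h2 : a * b + b * c + c * a = (e - 1) * (f - 1)) :
    HasSum (hyp3F2Term a b c e f) (Complex.Gamma e * Complex.Gamma f /
      (Complex.Gamma (a + 1) * Complex.Gamma (b + 1) * Complex.Gamma (c + 1))) := by
  have hs := summable_hyp3F2Term (a := a) (b := b) (c := c) he hf (by rw [h1]; simp)
  have hlim := tendsto_cpow_mul_hyp3F2Term (a := a + 1) (b := b + 1) (c := c + 1) he hf
  -- Raising the three upper parameters by one makes the exponent 0, so the closed form of the
  -- partial sums converges to the Gamma quotient itself.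
  rw [show e + f - (a + 1) - (b + 1) - (c + 1) + 1 = 0 by linear_combination h1] at hlim
  simp only [Complex.cpow_zero, one_mul] at hlim
  have h3 := hs.hasSum.tendsto_sum_nat.comp (tendsto_add_atTop_nat 2)
  rw [tendsto_nhds_unique (hlim.congr fun m => (sum_range_hyp3F2Term he hf h1 h2 _).symm) h3]
  exact hs.hasSum

/-! ### Gauss's summation theorem -/

theorem hyp3F2Term_one_one (a b z : ℂ) (k : ℕ) : hyp3F2Term a b 1 1 z k =
    (ascPochhammer ℂ k).eval a * (ascPochhammer ℂ k).eval b /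
      ((ascPochhammer ℂ k).eval z * k.factorial) := by
  have h : (ascPochhammer ℂ k).eval (1 : ℂ) ≠ 0 :=
    ascPochhammer_eval_ne_zero not_isGammaPole_one k
  rw [hyp3F2Term, mul_assoc (Polynomial.eval 1 _), mul_comm (Polynomial.eval 1 _),
    mul_div_mul_right _ _ h]

theorem hyp3F2Term_eq_one_one_mul (a b c e z : ℂ) (k : ℕ) : hyp3F2Term a b c e z k =
    hyp3F2Term a b 1 1 z k * ((ascPochhammer ℂ k).eval c / (ascPochhammer ℂ k).eval e) := by
  rw [hyp3F2Term_one_one, hyp3F2Term, div_mul_div_comm]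
  congr 1
  ring

theorem hyp3F2Term_add_one {a b c e z : ℂ} (hz : ¬ IsGammaPole z) (k : ℕ) :
    hyp3F2Term a b c e (z + 1) k = hyp3F2Term a b c e z k * (z / (z + k)) := by
  have h0 := ne_zero_of_not_isGammaPole hz
  have h1 := add_natCast_ne_zero hz k
  have h := mul_ascPochhammer_eval_add_one z k
  rw [mul_comm, ← eq_div_iff h0] at h
  rw [hyp3F2Term, hyp3F2Term, h, div_mul_div_comm, ← mul_div_assoc, div_mul_eq_mul_div,
    div_div_eq_mul_div]
  congr 1
  ring

theorem mul_hyp3F2Term_add_one_add_one {a b c e z : ℂ} (hz : ¬ IsGammaPole z) (k : ℕ) :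
    a * b / z * hyp3F2Term (a + 1) (b + 1) c e (z + 1) k =
      hyp3F2Term a b c e z k * ((a + k) * (b + k) / (z + k)) := by
  have h0 := ne_zero_of_not_isGammaPole hz
  rw [hyp3F2Term, hyp3F2Term, div_mul_div_comm, div_mul_div_comm]
  congr 1
  · calc _ = (a * (ascPochhammer ℂ k).eval (a + 1)) * (b * (ascPochhammer ℂ k).eval (b + 1)) *
          (ascPochhammer ℂ k).eval c := by ring
      _ = _ := by simp only [mul_ascPochhammer_eval_add_one]; ring
  · calc _ = (z * (ascPochhammer ℂ k).eval (z + 1)) *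
          ((ascPochhammer ℂ k).eval e * k.factorial) := by ring
      _ = _ := by simp only [mul_ascPochhammer_eval_add_one]; ring

theorem summable_hyp3F2Term_one_one {a b z : ℂ} (hz : ¬ IsGammaPole z)
    (hs : 0 < (z - a - b).re) : Summable (hyp3F2Term a b 1 1 z) :=
  summable_hyp3F2Term not_isGammaPole_one hz (by
    rwa [show 1 + z - a - b - 1 = z - a - b by ring])

/-- The termwise difference telescopes, with certificate -t_k (a + k)(b + k)/(z + k). This is a
multiple of a term of excess z - a - b - 1, hence tends to 0. -/
theorem tsum_hyp3F2Term_one_one_contiguous {a b z : ℂ} (hz : ¬ IsGammaPole z)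
    (hs : 0 < (z - a - b).re) :
    (z - a - b) * ∑' k, hyp3F2Term a b 1 1 z k =
      (z - a) * (z - b) / z * ∑' k, hyp3F2Term a b 1 1 (z + 1) k := by
  have hz1 := not_isGammaPole_add_one hz
  have hS := summable_hyp3F2Term_one_one hz hs
  have hS1 := summable_hyp3F2Term_one_one (a := a) (b := b) hz1 (by
    simp only [Complex.sub_re, Complex.add_re, Complex.one_re] at hs ⊢; linarith)
  have hH : Tendsto (fun k => -(a * b / z * hyp3F2Term (a + 1) (b + 1) 1 1 (z + 1) k)) atTop
      (𝓝 0) := by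
    have := (tendsto_hyp3F2Term_zero (a := a + 1) (b := b + 1) (c := 1) not_isGammaPole_one hz1 (by
      simp only [Complex.sub_re, Complex.add_re, Complex.one_re] at hs ⊢; linarith)).const_mul
        (a * b / z)
    simpa using this.neg
  have h0 := ne_zero_of_not_isGammaPole hz
  refine (hS.hasSum.mul_left (z - a - b)).unique
    (hasSum_of_telescoping (hS.mul_left _) (hS1.hasSum.mul_left _) hH ?_ fun k => ?_)
  · simp only [hyp3F2Term_zero]
    field_simp
    ring
  · have h1 := add_natCast_ne_zero hz k
    have h2 := add_natCast_ne_zero hz (k + 1)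
    have h3 : (k : ℂ) + 1 ≠ 0 := by exact_mod_cast k.succ_ne_zero
    simp only [mul_hyp3F2Term_add_one_add_one hz]
    simp only [hyp3F2Term_add_one hz, hyp3F2Term_succ]
    push_cast at h2 ⊢
    have h4 : (1 : ℂ) + k ≠ 0 := by rwa [add_comm]
    field_simp
    ring

theorem norm_ascPochhammer_eval_le {x : ℝ} {w : ℂ} (hx : 0 < x) (hw : x ≤ w.re) (k : ℕ) :
    ‖(ascPochhammer ℂ k).eval (x : ℂ)‖ ≤ ‖(ascPochhammer ℂ k).eval w‖ := by
  rw [ascPochhammer_eval_eq_prod, ascPochhammer_eval_eq_prod, norm_prod, norm_prod]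
  refine Finset.prod_le_prod (fun j _ => norm_nonneg _) fun j _ => ?_
  calc ‖(x : ℂ) + j‖ = x + j := by
        rw [← Complex.ofReal_natCast, ← Complex.ofReal_add, Complex.norm_of_nonneg (by positivity)]
    _ ≤ (w + j).re := by simpa using hw
    _ ≤ ‖w + j‖ := Complex.re_le_norm _

/-- A majorant uniform on a half-plane, used both for dominated convergence and for holomorphy of
the sum in the last lower parameter. -/
theorem norm_hyp3F2Term_le {x : ℝ} {w : ℂ} (hx : 0 < x) (hw : x ≤ w.re) (a b c e : ℂ) (k : ℕ) :
    ‖hyp3F2Term a b c e w k‖ ≤ ‖hyp3F2Term a b c e x k‖ := by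
  by_cases he : (ascPochhammer ℂ k).eval e = 0
  · simp [hyp3F2Term, he]
  have h0 : 0 < ‖(ascPochhammer ℂ k).eval (x : ℂ)‖ :=
    norm_pos_iff.2 (ascPochhammer_eval_ne_zero (not_isGammaPole_of_re_pos (by simpa using hx)) k)
  have h1 : 0 < ‖(ascPochhammer ℂ k).eval e‖ := norm_pos_iff.2 he
  have h2 : 0 < ‖(k.factorial : ℂ)‖ := by
    rw [norm_pos_iff]; exact_mod_cast k.factorial_ne_zero
  simp only [hyp3F2Term, norm_div, norm_mul]
  have := norm_ascPochhammer_eval_le hx hw k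
  gcongr

theorem tendsto_tsum_hyp3F2Term_one_one (a b z : ℂ) :
    Tendsto (fun N : ℕ => ∑' k, hyp3F2Term a b 1 1 (z + N) k) atTop (𝓝 1) := by
  obtain ⟨x, hx⟩ : ∃ x : ℝ, 0 < x ∧ (a + b).re < x :=
    ⟨max 0 (a + b).re + 1, by positivity, by linarith [le_max_right 0 (a + b).re]⟩
  have hx0 : ¬ IsGammaPole (x : ℂ) := not_isGammaPole_of_re_pos (by simpa using hx.1)
  have hsum : Summable fun k => ‖hyp3F2Term a b 1 1 (x : ℂ) k‖ :=
    (summable_hyp3F2Term_one_one hx0 (by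
      have := hx.2
      simp only [Complex.add_re, Complex.sub_re, Complex.ofReal_re] at this ⊢
      linarith)).norm
  have htop : Tendsto (fun N : ℕ => z.re + N) atTop atTop :=
    tendsto_atTop_add_const_left _ _ tendsto_natCast_atTop_atTop
  have hnorm : Tendsto (fun N : ℕ => ‖z + N‖) atTop atTop :=
    tendsto_atTop_mono (fun N => by simpa using Complex.re_le_norm (z + N)) htop
  have hlim (k : ℕ) : Tendsto (fun N : ℕ => hyp3F2Term a b 1 1 (z + N) k) atTop
      (𝓝 (if k = 0 then 1 else 0)) := by
    rcases Nat.eq_zero_or_pos k with rfl | hk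
    · simp [hyp3F2Term_zero]
    · rw [if_neg hk.ne']
      have hp : Tendsto (fun N : ℕ => ‖(ascPochhammer ℂ k).eval (z + N)‖) atTop atTop :=
        Polynomial.tendsto_norm_atTop _ (by
          rw [Polynomial.degree_eq_natDegree (monic_ascPochhammer ℂ k).ne_zero,
            ascPochhammer_natDegree]
          exact_mod_cast hk) hnorm
      have hp' : Tendsto (fun N : ℕ => ((ascPochhammer ℂ k).eval (z + N))⁻¹) atTop (𝓝 0) := by
        rw [tendsto_zero_iff_norm_tendsto_zero]
        simp only [norm_inv]
        exact hp.inv_tendsto_atTop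
      have := hp'.const_mul ((ascPochhammer ℂ k).eval a * (ascPochhammer ℂ k).eval b / k.factorial)
      rw [mul_zero] at this
      refine this.congr fun N => ?_
      rw [hyp3F2Term_one_one, div_mul_eq_div_div_swap]
      exact (div_eq_mul_inv _ _).symm
  have h := tendsto_tsum_of_dominated_convergence hsum hlim (by
    filter_upwards [htop.eventually_ge_atTop x] with N hN k
    exact norm_hyp3F2Term_le hx.1 (by simpa using hN) _ _ _ _ k)
  rwa [tsum_ite_eq] at h

/-- The N-fold contiguous relation. Its prefactor is (z - a)_N (z - b)_N / ((z)_N (z - a - b)_N),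
disguised as a ₃F₂ term by (1)_N = N! so that the asymptotics of terms give its limit. -/
theorem tsum_hyp3F2Term_one_one_eq_mul {a b z : ℂ} (hz : ¬ IsGammaPole z)
    (hs : 0 < (z - a - b).re) (N : ℕ) :
    ∑' k, hyp3F2Term a b 1 1 z k =
      hyp3F2Term (z - a) (z - b) 1 z (z - a - b) N * ∑' k, hyp3F2Term a b 1 1 (z + N) k := by
  induction N with
  | zero => simp [hyp3F2Term_zero]
  | succ N ih =>
    have hN : 0 < (z + N - a - b).re := by
      have : (0 : ℝ) ≤ N := N.cast_nonneg
      simp only [Complex.sub_re, Complex.add_re, Complex.natCast_re] at hs ⊢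
      linarith
    have h := tsum_hyp3F2Term_one_one_contiguous (not_isGammaPole_add_natCast hz N) hN
    have h1 : z - a - b + N ≠ 0 := add_natCast_ne_zero (not_isGammaPole_of_re_pos hs) N
    rw [show z + N - a - b = z - a - b + N by ring, mul_comm, ← eq_div_iff h1] at h
    have h2 := add_natCast_ne_zero hz N
    have h3 : (N : ℂ) + 1 ≠ 0 := by exact_mod_cast N.succ_ne_zero
    have h4 : (1 : ℂ) + N ≠ 0 := by rwa [add_comm]
    rw [ih, h, hyp3F2Term_succ]
    push_cast
    rw [← add_assoc]
    field_simp
    ring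

/-- The sum of `₂F₁(a, b; z | 1)`. -/
noncomputable def gaussValue (a b z : ℂ) : ℂ :=
  Complex.Gamma z * Complex.Gamma (z - a - b) / (Complex.Gamma (z - a) * Complex.Gamma (z - b))

/-- **Gauss's summation theorem**. -/
theorem hasSum_hyp3F2Term_one_one {a b z : ℂ} (hz : ¬ IsGammaPole z)
    (hs : 0 < (z - a - b).re) : HasSum (hyp3F2Term a b 1 1 z) (gaussValue a b z) := by
  have hlim := tendsto_cpow_mul_hyp3F2Term (a := z - a) (b := z - b) (c := 1) hz
    (not_isGammaPole_of_re_pos hs)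
  rw [show z + (z - a - b) - (z - a) - (z - b) - 1 + 1 = 0 by ring] at hlim
  simp only [Complex.cpow_zero, one_mul, Complex.Gamma_one, mul_one] at hlim
  have h := hlim.mul ((tendsto_tsum_hyp3F2Term_one_one a b z).comp (tendsto_add_atTop_nat 1))
  rw [mul_one] at h
  have h2 := tendsto_nhds_unique
    (h.congr fun N => (tsum_hyp3F2Term_one_one_eq_mul hz hs (N + 1)).symm) tendsto_const_nhds
  rw [gaussValue, h2]
  exact (summable_hyp3F2Term_one_one hz hs).hasSum

/-! ### Continuation of `₃F₂(a, b, d; d + 1, z | 1)` in `z` -/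

theorem isOpen_not_isGammaPole : IsOpen {z : ℂ | ¬ IsGammaPole z} := by
  have h : {z : ℂ | ¬ IsGammaPole z} = (fun z => (Complex.Gamma z)⁻¹) ⁻¹' {0}ᶜ := by
    ext z
    simp only [Set.mem_ofPred_eq, Set.mem_preimage, Set.mem_compl_iff, Set.mem_singleton_iff,
      inv_eq_zero, Complex.Gamma_eq_zero_iff, IsGammaPole]
  rw [h]
  exact isOpen_compl_singleton.preimage Complex.differentiable_one_div_Gamma.continuous

theorem differentiableAt_Gamma_of_not_isGammaPole {z : ℂ} (hz : ¬ IsGammaPole z) :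
    DifferentiableAt ℂ Complex.Gamma z :=
  Complex.differentiableAt_Gamma z fun m hm => hz ⟨m, hm⟩

theorem differentiableAt_gaussValue {a b z : ℂ} (hz : ¬ IsGammaPole z)
    (hs : ¬ IsGammaPole (z - a - b)) : DifferentiableAt ℂ (gaussValue a b) z := by
  have h : gaussValue a b = fun w => Complex.Gamma w * Complex.Gamma (w - a - b) *
      ((Complex.Gamma (w - a))⁻¹ * (Complex.Gamma (w - b))⁻¹) := by
    funext w
    rw [gaussValue, div_eq_mul_inv, mul_inv]
  rw [h]
  refine ((differentiableAt_Gamma_of_not_isGammaPole hz).mul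
    ((differentiableAt_Gamma_of_not_isGammaPole hs).comp z (by fun_prop))).mul
    (DifferentiableAt.mul ?_ ?_)
  · exact (Complex.differentiable_one_div_Gamma _).comp z (f := fun w => w - a) (by fun_prop)
  · exact (Complex.differentiable_one_div_Gamma _).comp z (f := fun w => w - b) (by fun_prop)

theorem add_mul_ascPochhammer_div (d : ℂ) (hd : ¬ IsGammaPole (d + 1)) (k : ℕ) :
    (d + k) * ((ascPochhammer ℂ k).eval d / (ascPochhammer ℂ k).eval (d + 1)) = d := by
  have h := ascPochhammer_eval_ne_zero hd k
  have h1 := mul_ascPochhammer_eval_add_one d k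
  field_simp
  linear_combination -h1

theorem differentiableOn_hyp3F2Term (a b c e : ℂ) (k : ℕ) :
    DifferentiableOn ℂ (fun w => hyp3F2Term a b c e w k) {w | ¬ IsGammaPole w} := by
  intro w hw
  by_cases he : (ascPochhammer ℂ k).eval e = 0
  · simp only [hyp3F2Term, he, zero_mul, div_zero]
    exact differentiableWithinAt_const _
  · refine DifferentiableAt.differentiableWithinAt ?_
    simp only [hyp3F2Term]
    have h1 : (k.factorial : ℂ) ≠ 0 := by exact_mod_cast k.factorial_ne_zero
    exact DifferentiableAt.div (by fun_prop) (by fun_prop)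
      (mul_ne_zero (mul_ne_zero he (ascPochhammer_eval_ne_zero hw k)) h1)

theorem differentiableAt_tsum_hyp3F2Term {a b c e : ℂ} (he : ¬ IsGammaPole e) {x : ℝ}
    (hx : 0 < x) (hs : 0 < (e + x - a - b - c).re) {z : ℂ} (hz : x < z.re) :
    DifferentiableAt ℂ (fun w => ∑' k, hyp3F2Term a b c e w k) z := by
  have hU : IsOpen {w : ℂ | x < w.re} := isOpen_lt continuous_const Complex.continuous_re
  have hx0 : ¬ IsGammaPole (x : ℂ) := not_isGammaPole_of_re_pos (by simpa using hx)
  have h := Complex.differentiableOn_tsum_of_summable_norm (F := fun k w => hyp3F2Term a b c e w k)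
    (summable_hyp3F2Term he hx0 hs).norm
    (fun k => (differentiableOn_hyp3F2Term a b c e k).mono fun w (hw : x < w.re) =>
      not_isGammaPole_of_re_pos (hx.trans hw)) hU
    fun k w hw => norm_hyp3F2Term_le hx (le_of_lt hw) _ _ _ _ k
  exact h.differentiableAt (hU.mem_nhds hz)

/-- Holds term by term: with q = (d)_k/(d + 1)_k one has d = (d + k)q, so (z - d)q + d = (z + k)q.
-/
theorem tsum_hyp3F2Term_unit_shift {a b d z : ℂ} (hd : ¬ IsGammaPole (d + 1))
    (hz : ¬ IsGammaPole z) (hs : 0 < (z + 1 - a - b).re) :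
    ∑' k, hyp3F2Term a b d (d + 1) z k =
      (z - d) / z * ∑' k, hyp3F2Term a b d (d + 1) (z + 1) k + d / z * gaussValue a b (z + 1) := by
  have hz1 := not_isGammaPole_add_one hz
  have h1 : Summable (hyp3F2Term a b d (d + 1) (z + 1)) := summable_hyp3F2Term hd hz1 (by
    simp only [Complex.sub_re, Complex.add_re, Complex.one_re] at hs ⊢; linarith)
  have h2 := hasSum_hyp3F2Term_one_one hz1 hs
  refine HasSum.tsum_eq (((h1.hasSum.mul_left _).add (h2.mul_left _)).congr_fun ?_)
  intro k
  have h0 := ne_zero_of_not_isGammaPole hz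
  have hk := add_natCast_ne_zero hz k
  have hq := add_mul_ascPochhammer_div d hd k
  simp only [hyp3F2Term_eq_one_one_mul a b d, hyp3F2Term_add_one hz]
  generalize (ascPochhammer ℂ k).eval d / (ascPochhammer ℂ k).eval (d + 1) = q at hq ⊢
  field_simp
  linear_combination hyp3F2Term a b 1 1 z k * hq

/-- The continuation of `₃F₂(a, b, d; d + 1, z | 1)` by `N` unit steps to the left. -/
noncomputable def hyp3F2Step (a b d : ℂ) : ℕ → ℂ → ℂ
  | 0, z => ∑' k, hyp3F2Term a b d (d + 1) z k
  | N + 1, z => (z - d) / z * hyp3F2Step a b d N (z + 1) + d / z * gaussValue a b (z + 1)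

theorem hyp3F2Step_eq_tsum {a b d : ℂ} (hd : ¬ IsGammaPole (d + 1)) (N : ℕ) {z : ℂ}
    (hz : ¬ IsGammaPole z) (hs : 0 < (z + 1 - a - b).re) :
    hyp3F2Step a b d N z = ∑' k, hyp3F2Term a b d (d + 1) z k := by
  induction N generalizing z with
  | zero => rfl
  | succ N ih =>
    rw [hyp3F2Step, ih (not_isGammaPole_add_one hz) (by
      simp only [Complex.sub_re, Complex.add_re, Complex.one_re] at hs ⊢; linarith),
      tsum_hyp3F2Term_unit_shift hd hz hs]

/-- Once the steps reach the half-plane of convergence, further steps change nothing; the number of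
steps may therefore depend on z. -/
theorem hyp3F2Step_add {a b d : ℂ} (hd : ¬ IsGammaPole (d + 1)) (N M : ℕ) {z : ℂ}
    (hz : ¬ IsGammaPole z) (hs : 0 < (z + 1 - a - b).re + N) :
    hyp3F2Step a b d (N + M) z = hyp3F2Step a b d N z := by
  induction N generalizing z with
  | zero =>
    rw [Nat.cast_zero, add_zero] at hs
    rw [hyp3F2Step_eq_tsum hd _ hz hs, hyp3F2Step_eq_tsum hd _ hz hs]
  | succ N ih =>
    rw [Nat.add_right_comm, hyp3F2Step, hyp3F2Step, ih (not_isGammaPole_add_one hz) (by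
      push_cast at hs
      simp only [Complex.sub_re, Complex.add_re, Complex.one_re] at hs ⊢; linarith)]

theorem hyp3F2Step_congr {a b d : ℂ} (hd : ¬ IsGammaPole (d + 1)) {N M : ℕ} {z : ℂ}
    (hz : ¬ IsGammaPole z) (hN : 0 < (z + 1 - a - b).re + N) (hM : 0 < (z + 1 - a - b).re + M) :
    hyp3F2Step a b d N z = hyp3F2Step a b d M z := by
  rw [← hyp3F2Step_add hd N M hz hN, add_comm, hyp3F2Step_add hd M N hz hM]

theorem differentiableAt_hyp3F2Step {a b d : ℂ} (hd : ¬ IsGammaPole (d + 1)) {x : ℝ}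
    (hx : 0 < x) (hxab : (a + b).re - 1 < x) (N : ℕ) {z : ℂ} (hz : ¬ IsGammaPole z)
    (hs : ¬ IsGammaPole (z + 1 - a - b)) (hN : x < z.re + N) :
    DifferentiableAt ℂ (hyp3F2Step a b d N) z := by
  induction N generalizing z with
  | zero =>
    exact differentiableAt_tsum_hyp3F2Term hd hx (by
      simp only [Complex.sub_re, Complex.add_re, Complex.one_re, Complex.ofReal_re] at hxab ⊢
      linarith) (by simpa using hN)
  | succ N ih =>
    have hz0 := ne_zero_of_not_isGammaPole hz
    have hz1 := not_isGammaPole_add_one hz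
    have hs1 : ¬ IsGammaPole (z + 1 + 1 - a - b) := by
      rw [show z + 1 + 1 - a - b = z + 1 - a - b + 1 by ring]
      exact not_isGammaPole_add_one hs
    have h1 := (ih hz1 hs1 (by
      push_cast at hN; simp only [Complex.add_re, Complex.one_re]; linarith)).comp z
        (f := fun w => w + 1) (by fun_prop)
    have h2 := (differentiableAt_gaussValue hz1 hs).comp z (f := fun w => w + 1) (by fun_prop)
    have h3 : DifferentiableAt ℂ (fun w : ℂ => (w - d) / w) z :=
      DifferentiableAt.div (by fun_prop) (by fun_prop) hz0
    have h4 : DifferentiableAt ℂ (fun w : ℂ => d / w) z :=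
      DifferentiableAt.div (by fun_prop) (by fun_prop) hz0
    exact (h3.mul h1).add (h4.mul h2)

theorem exists_continuation_hyp3F2_unit_shift (a b : ℂ) {d : ℂ} (hd : ¬ IsGammaPole (d + 1)) :
    ∃ R : ℂ → ℂ,
      (∀ z, ¬ IsGammaPole z → ¬ IsGammaPole (z + 1 - a - b) → DifferentiableAt ℂ R z) ∧
      ∀ z, ¬ IsGammaPole z → 0 < (z + 1 - a - b).re →
        HasSum (hyp3F2Term a b d (d + 1) z) (R z) := by
  obtain ⟨x, hx, hxab⟩ : ∃ x : ℝ, 0 < x ∧ (a + b).re - 1 < x :=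
    ⟨max 0 ((a + b).re - 1) + 1, by positivity, by linarith [le_max_right 0 ((a + b).re - 1)]⟩
  have hpos {z : ℂ} {N : ℕ} (h : x < z.re + N) : 0 < (z + 1 - a - b).re + N := by
    simp only [Complex.sub_re, Complex.add_re, Complex.one_re] at hxab ⊢
    linarith
  have hidx (z : ℂ) : x < z.re + (⌈x - z.re⌉₊ + 1 : ℕ) := by
    have := Nat.le_ceil (x - z.re)
    push_cast
    linarith
  -- The number of steps jumps with re z, but near each point the function agrees with the one whose
  -- number of steps is frozen there.
  refine ⟨fun z => hyp3F2Step a b d (⌈x - z.re⌉₊ + 1) z, fun z hz hs => ?_, fun z hz hs => ?_⟩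
  · refine (differentiableAt_hyp3F2Step hd hx hxab _ hz hs (hidx z)).congr_of_eventuallyEq ?_
    have hU : IsOpen {w : ℂ | x < w.re + (⌈x - z.re⌉₊ + 1 : ℕ)} :=
      isOpen_lt continuous_const (by fun_prop)
    filter_upwards [isOpen_not_isGammaPole.mem_nhds hz, hU.mem_nhds (hidx z)] with w hw hwx
    exact hyp3F2Step_congr hd hw (hpos (hidx w)) (hpos hwx)
  · simp only [hyp3F2Step_eq_tsum hd _ hz hs]
    refine (summable_hyp3F2Term hd hz ?_).hasSum
    rwa [show d + 1 + z - a - b - d = z + 1 - a - b by ring]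

/-! ### The series `₃F₂(a, b, c; c + 2, z | 1)` -/

theorem hasSum_hyp3F2Term_add_two {a b c z R : ℂ} (hc : ¬ IsGammaPole (c + 2))
    (hz : ¬ IsGammaPole z) (hs : 0 < (z + 2 - a - b).re)
    (hR : HasSum (hyp3F2Term a b (c + 1) (c + 1 + 1) (z + 1)) R) :
    HasSum (hyp3F2Term a b c (c + 2) z)
      ((1 + c) * (z + 1 - a) * (z + 1 - b) / (z * (z + 1)) * gaussValue a b (z + 2) -
        ((a - 1) * (b - 1) - c * (a + b - 1 - z)) / z * R) := by
  have hc' : c + 1 + 1 = c + 2 := by ring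
  rw [hc'] at hR
  have hz1 := not_isGammaPole_add_one hz
  have hz2 : z + 2 = z + 1 + 1 := by ring
  have hz2' : ¬ IsGammaPole (z + 2) := hz2 ▸ not_isGammaPole_add_one hz1
  have hG := hasSum_hyp3F2Term_one_one hz2' hs
  have hT : Summable (hyp3F2Term a b c (c + 2) z) := summable_hyp3F2Term hc hz (by
    rwa [show c + 2 + z - a - b - c = z + 2 - a - b by ring])
  -- The last factor of the certificate raises the lower parameter z + 1 to z + 2. The resulting
  -- term has excess z + 1 - a - b, of real part above -1, so it tends to 0.
  have hH : Tendsto (fun k => (z - c) / (z + 1) * (a * b / z *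
      hyp3F2Term (a + 1) (b + 1) (c + 1) (c + 2) (z + 1) k * ((z + 1) / (z + 1 + k)))) atTop
      (𝓝 0) := by
    have h := (tendsto_hyp3F2Term_zero (a := a + 1) (b := b + 1) (c := c + 1) hc hz2' (by
      rw [show c + 2 + (z + 2) - (a + 1) - (b + 1) - (c + 1) = z + 2 - a - b - 1 by ring,
        Complex.sub_re, Complex.one_re]
      linarith)).const_mul ((z - c) / (z + 1) * (a * b / z))
    rw [mul_zero] at h
    refine h.congr fun k => ?_
    rw [hz2, hyp3F2Term_add_one hz1]
    ring
  refine hasSum_of_telescoping hT ((hG.mul_left _).sub (hR.mul_left _)) hH ?_ fun k => ?_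
  · have h0 := ne_zero_of_not_isGammaPole hz
    have h1 := ne_zero_of_not_isGammaPole hz1
    simp only [hyp3F2Term_zero, Nat.cast_zero, add_zero]
    field_simp
    ring
  · have h0 := ne_zero_of_not_isGammaPole hz
    have h1 := ne_zero_of_not_isGammaPole hz1
    have hk0 := add_natCast_ne_zero hz k
    have hk1 := add_natCast_ne_zero hz1 k
    have hk2 := add_natCast_ne_zero hz2' k
    have hck := add_natCast_ne_zero hc k
    have hk : (k : ℂ) + 1 ≠ 0 := by exact_mod_cast k.succ_ne_zero
    have hq := add_mul_ascPochhammer_div (c + 1) (hc' ▸ hc) k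
    rw [hc'] at hq
    have hpk : (ascPochhammer ℂ (k + 1)).eval c / (ascPochhammer ℂ (k + 1)).eval (c + 2) =
        c / (c + 2 + k) *
          ((ascPochhammer ℂ k).eval (c + 1) / (ascPochhammer ℂ k).eval (c + 2)) := by
      rw [ascPochhammer_succ_eval, ← mul_ascPochhammer_eval_add_one, ascPochhammer_succ_eval,
        div_mul_div_comm, mul_comm (c + 2 + (k : ℂ))]
    have hqk : (ascPochhammer ℂ (k + 1)).eval (c + 1) / (ascPochhammer ℂ (k + 1)).eval (c + 2) =
        (c + 1 + k) / (c + 2 + k) *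
          ((ascPochhammer ℂ k).eval (c + 1) / (ascPochhammer ℂ k).eval (c + 2)) := by
      rw [ascPochhammer_succ_eval, ascPochhammer_succ_eval, div_mul_div_comm, mul_comm (c + 1 + _),
        mul_comm (c + 2 + (k : ℂ))]
    simp only [mul_hyp3F2Term_add_one_add_one hz, hz2]
    simp only [hyp3F2Term_add_one hz1, hyp3F2Term_add_one hz]
    simp only [hyp3F2Term_eq_one_one_mul a b c, hyp3F2Term_eq_one_one_mul a b (c + 1), hpk, hqk,
      hyp3F2Term_succ a b 1 1]
    rw [show (1 : ℂ) + c = c + 1 by ring]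
    generalize (ascPochhammer ℂ k).eval (c + 1) / (ascPochhammer ℂ k).eval (c + 2) = q at hq ⊢
    generalize hyp3F2Term a b 1 1 z k = U
    rw [show (1 : ℂ) + k = k + 1 by ring]
    have hk0' : z + (k + 1) ≠ 0 := by rwa [show z + ((k : ℂ) + 1) = z + 1 + k by ring]
    have hk1' : z + 1 + (k + 1) ≠ 0 := by rwa [show z + 1 + ((k : ℂ) + 1) = z + 2 + k by ring]
    push_cast
    -- Writing c + 1 as (c + 1 + k)q in the Gauss coefficient puts q into every summand, leaving a
    -- rational identity.
    nth_rw 1 [← hq]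
    field_simp
    ring

theorem Hyp3F2AtOneEq.rotate {a b c e f v : ℂ} (h : Hyp3F2AtOneEq b c a e f v) :
    Hyp3F2AtOneEq a b c e f v := by
  have hterm (z : ℂ) : hyp3F2Term b c a e z = hyp3F2Term a b c e z := by
    funext k
    rw [hyp3F2Term, hyp3F2Term]
    congr 1
    ring
  have hs (z : ℂ) : e + z - b - c - a = e + z - a - b - c := by ring
  simpa only [Hyp3F2AtOneEq, hyp3F2Domain, hterm, hs] using h

theorem Hyp3F2AtOneEq.hasSum {a b c e f v : ℂ} (h : Hyp3F2AtOneEq a b c e f v)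
    (hs : 0 < (e + f - a - b - c).re) : HasSum (hyp3F2Term a b c e f) v := by
  obtain ⟨-, hf, F, -, hF, rfl⟩ := h
  exact hF f hf hs

theorem inv_Gamma_add_one (z : ℂ) : (Complex.Gamma z)⁻¹ = z * (Complex.Gamma (z + 1))⁻¹ :=
  Complex.one_div_Gamma_eq_self_mul_one_div_Gamma_add_one z

/-- Stated through 1/Γ, which absorbs the factors z + 1 - a and z + 1 - b even where they vanish. -/
theorem mul_gaussValue_add_two {a b z : ℂ} (hz : ¬ IsGammaPole z) :
    (z + 1 - a) * (z + 1 - b) / (z * (z + 1)) * gaussValue a b (z + 2) =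
      Complex.Gamma z * Complex.Gamma (z + 2 - a - b) *
        ((Complex.Gamma (z + 1 - a))⁻¹ * (Complex.Gamma (z + 1 - b))⁻¹) := by
  have h0 := ne_zero_of_not_isGammaPole hz
  have h1 := ne_zero_of_not_isGammaPole (not_isGammaPole_add_one hz)
  rw [inv_Gamma_add_one (z + 1 - a), inv_Gamma_add_one (z + 1 - b), gaussValue,
    show z + 2 = z + 1 + 1 by ring, Complex.Gamma_add_one _ h1, Complex.Gamma_add_one _ h0,
    show z + 1 + 1 - a = z + 1 - a + 1 by ring, show z + 1 + 1 - b = z + 1 - b + 1 by ring,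
    div_eq_mul_inv _ (Complex.Gamma _ * _), mul_inv]
  field_simp

/-- The value at `1` of `₃F₂(a, b, c; c + 2, z)` under one condition on the parameters. -/
theorem hyp3F2AtOneEq_add_two {a b c z : ℂ} (hc : ¬ IsGammaPole (c + 2)) (hz : ¬ IsGammaPole z)
    (hs : ¬ IsGammaPole (z + 2 - a - b)) (h : (a - 1) * (b - 1) = c * (a + b - 1 - z)) :
    Hyp3F2AtOneEq a b c (c + 2) z ((1 + c) * (Complex.Gamma z * Complex.Gamma (z + 2 - a - b) *
      ((Complex.Gamma (z + 1 - a))⁻¹ * (Complex.Gamma (z + 1 - b))⁻¹))) := by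
  obtain ⟨R, hRd, hRs⟩ := exists_continuation_hyp3F2_unit_shift a b (d := c + 1)
    (by rwa [show c + 1 + 1 = c + 2 by ring])
  have hexc (w : ℂ) : c + 2 + w - a - b - c = w + 2 - a - b := by ring
  have hexc' (w : ℂ) : w + 1 + 1 - a - b = w + 2 - a - b := by ring
  refine ⟨hc, ⟨hz, by rwa [hexc]⟩,
    -- The condition `h` kills the second summand only at w = z; elsewhere it is needed for the
    -- function to continue the series.
    fun w => (1 + c) * (w + 1 - a) * (w + 1 - b) / (w * (w + 1)) * gaussValue a b (w + 2) -
      ((a - 1) * (b - 1) - c * (a + b - 1 - w)) / w * R (w + 1), ?_, ?_, ?_⟩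
  · rintro w ⟨hw, hws⟩
    rw [hexc] at hws
    have hw1 := not_isGammaPole_add_one hw
    have h0 := ne_zero_of_not_isGammaPole hw
    have h1 := ne_zero_of_not_isGammaPole hw1
    have hw2 : ¬ IsGammaPole (w + 2) := by simpa using not_isGammaPole_add_natCast hw 2
    have d1 := (differentiableAt_gaussValue hw2 hws).comp w (f := fun w => w + 2) (by fun_prop)
    have d2 := (hRd (w + 1) hw1 (by rwa [hexc'])).comp w (f := fun w => w + 1) (by fun_prop)
    have d3 : DifferentiableAt ℂ
        (fun w : ℂ => (1 + c) * (w + 1 - a) * (w + 1 - b) / (w * (w + 1))) w :=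
      DifferentiableAt.div (by fun_prop) (by fun_prop) (mul_ne_zero h0 h1)
    have d4 : DifferentiableAt ℂ
        (fun w : ℂ => ((a - 1) * (b - 1) - c * (a + b - 1 - w)) / w) w :=
      DifferentiableAt.div (by fun_prop) (by fun_prop) h0
    exact ((d3.mul d1).sub (d4.mul d2)).differentiableWithinAt
  · rintro w ⟨hw, -⟩ hws
    rw [hexc] at hws
    exact hasSum_hyp3F2Term_add_two hc hw hws
      (hRs (w + 1) (not_isGammaPole_add_one hw) (by rwa [hexc']))
  · simp only [h, sub_self, zero_div, zero_mul, sub_zero]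
    rw [← mul_gaussValue_add_two hz]
    ring

/-! ### Integer shifts and reflection -/

theorem inv_Gamma_eq_sin_mul {z : ℂ} (hz : ¬ IsGammaPole (1 - z)) :
    (Complex.Gamma z)⁻¹ = Complex.sin (Real.pi * z) * Complex.Gamma (1 - z) / Real.pi := by
  have h := Complex.Gamma_mul_Gamma_one_sub z
  have h1 := Gamma_ne_zero_of_not_isGammaPole hz
  rw [← eq_div_iff h1] at h
  rw [h, div_div, inv_div, mul_comm (Complex.sin _)]

theorem sin_pi_mul_sub {n : ℕ} {m : ℂ} (hm : m = n ∨ m = -n) (x : ℂ) :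
    Complex.sin (Real.pi * (x - m)) = (-1) ^ n * Complex.sin (Real.pi * x) := by
  rcases hm with rfl | rfl
  · rw [← Complex.sin_antiperiodic.sub_nat_mul_eq]
    ring_nf
  · rw [← Complex.sin_antiperiodic.add_nat_mul_eq]
    ring_nf

theorem sin_pi_mul_one_sub (x : ℂ) :
    Complex.sin (Real.pi * (1 - x)) = Complex.sin (Real.pi * x) := by
  rw [← Complex.sin_pi_sub]
  ring_nf

theorem not_isGammaPole_add_int_of_sin_ne_zero {a : ℂ} (ha : Complex.sin (Real.pi * a) ≠ 0)
    (j : ℤ) : ¬ IsGammaPole (a + j) := by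
  rintro ⟨k, hk⟩
  refine ha (Complex.sin_eq_zero_iff.2 ⟨-k - j, ?_⟩)
  push_cast
  linear_combination (Real.pi : ℂ) * hk

theorem not_isGammaPole_sub_add_one_of_sin_ne_zero {a m : ℂ} {n : ℕ} (hm : m = n ∨ m = -n)
    (ha : Complex.sin (Real.pi * a) ≠ 0) : ¬ IsGammaPole (a - m + 1) := by
  rcases hm with rfl | rfl
  · simpa [sub_eq_add_neg, add_assoc] using
      not_isGammaPole_add_int_of_sin_ne_zero ha (-(n : ℤ) + 1)
  · simpa [sub_eq_add_neg, add_assoc] using not_isGammaPole_add_int_of_sin_ne_zero ha (n + 1)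

/-! ### The evaluations, with `m = ± n` -/

/-- Here `hx` is exactly the quadratic condition of the excess-two summation. Reflection at b + 1
and at m - a produces the sines, and integrality of m the sign. -/
theorem hasSum_excess_two_shift {n : ℕ} {m a b x : ℂ} (hm : m = n ∨ m = -n)
    (ha : Complex.sin (Real.pi * a) ≠ 0) (hb : ¬ IsGammaPole (-b))
    (he : ¬ IsGammaPole (1 + b + x)) (hx : x * (b + m) = a * m) :
    HasSum (hyp3F2Term a b (x - m) (1 + b + x) (a - m + 1))
      ((-1) ^ n * Complex.sin (Real.pi * b) * Complex.Gamma (1 + b + x) * Complex.Gamma (-b) /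
        (Complex.sin (Real.pi * a) * Complex.Gamma (1 + a) * Complex.Gamma (1 - m + x) *
          Complex.Gamma (m - a))) := by
  have hf := not_isGammaPole_sub_add_one_of_sin_ne_zero hm ha
  have h := hasSum_hyp3F2Term_of_excess_eq_two (a := a) (b := b) (c := x - m) he hf (by ring)
    (by linear_combination hx)
  have hb' := inv_Gamma_eq_sin_mul (z := b + 1) (by rwa [show 1 - (b + 1) = -b by ring])
  have hf' := inv_Gamma_eq_sin_mul (z := m - a) (by rwa [show 1 - (m - a) = a - m + 1 by ring])
  rw [show 1 - (b + 1) = -b by ring, show Real.pi * (b + 1) = Real.pi * b + Real.pi by ring,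
    Complex.sin_add_pi] at hb'
  rw [show 1 - (m - a) = a - m + 1 by ring, show Real.pi * (m - a) = -(Real.pi * (a - m)) by ring,
    Complex.sin_neg, sin_pi_mul_sub hm] at hf'
  have hpi : (Real.pi : ℂ) ≠ 0 := by exact_mod_cast Real.pi_ne_zero
  have hsq : ((-1 : ℂ) ^ n) * (-1) ^ n = 1 := by rw [← mul_pow]; simp
  convert h using 1
  rw [div_eq_mul_inv, div_eq_mul_inv, mul_inv, mul_inv, mul_inv, mul_inv, mul_inv, hb', hf',
    add_comm 1 a, show 1 - m + x = x - m + 1 by ring]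
  linear_combination -Complex.sin (Real.pi * b) * Complex.Gamma (1 + b + x) * Complex.Gamma (-b) *
    Complex.Gamma (a - m + 1) * (Complex.Gamma (a + 1))⁻¹ * (Complex.Gamma (x - m + 1))⁻¹ /
    Real.pi * (hsq + (-1) ^ n * (-1) ^ n * mul_inv_cancel₀ ha)

/-- The pair a, a + 2 plays the role of c, c + 2, and `hx` is the vanishing condition. Two
reflections each give (-1)^n, and these signs cancel. -/
theorem hyp3F2AtOneEq_int_shift {n : ℕ} {m a b x : ℂ} (hm : m = n ∨ m = -n)
    (ha : Complex.sin (Real.pi * a) ≠ 0) (hs : ¬ IsGammaPole (2 - b + (m - x)))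
    (hxm : ¬ IsGammaPole (x - m)) (hx : x * (1 + a - b) = a * m) :
    Hyp3F2AtOneEq a b (1 + a + x) (2 + a) (1 + a + m)
      (-(Complex.sin (Real.pi * x) * (1 + a) * Complex.Gamma (2 - b + (m - x)) *
          Complex.Gamma (x - m) /
        (Complex.sin (Real.pi * a) * Complex.Gamma (-b + a + 2 + m) *
          Complex.Gamma (-a - m)))) := by
  have hz : ¬ IsGammaPole (1 + a + m) := by
    have := not_isGammaPole_sub_add_one_of_sin_ne_zero (m := -m) (n := n)
      (by rcases hm with rfl | rfl <;> simp) ha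
    rwa [show a - -m + 1 = 1 + a + m by ring] at this
  have he : ¬ IsGammaPole (a + 2) := by
    simpa using not_isGammaPole_add_int_of_sin_ne_zero ha 2
  have h := hyp3F2AtOneEq_add_two (a := b) (b := 1 + a + x) (c := a) he hz
    (by rwa [show 1 + a + m + 2 - b - (1 + a + x) = 2 - b + (m - x) by ring])
    (by linear_combination -hx)
  have h1 := inv_Gamma_eq_sin_mul (z := 1 - (x - m)) (by rwa [sub_sub_cancel])
  rw [sub_sub_cancel, sin_pi_mul_one_sub, sin_pi_mul_sub hm] at h1
  have h2 := inv_Gamma_eq_sin_mul (z := -a - m)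
    (by rwa [show 1 - (-a - m) = 1 + a + m by ring])
  rw [show 1 - (-a - m) = 1 + a + m by ring, sin_pi_mul_sub hm, mul_neg, Complex.sin_neg] at h2
  have hpi : (Real.pi : ℂ) ≠ 0 := by exact_mod_cast Real.pi_ne_zero
  convert h.rotate using 1
  · ring
  · rw [show 1 + a + m + 2 - b - (1 + a + x) = 2 - b + (m - x) by ring,
      show 1 + a + m + 1 - (1 + a + x) = 1 - (x - m) by ring, h1, div_eq_mul_inv, mul_inv,
      mul_inv, h2, show 1 + a + m + 1 - b = -b + a + 2 + m by ring]
    field_simp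

/-- Here c = a - m - 1 and `hy` is the vanishing condition. No sine is shifted by m, so m may be any
complex number. -/
theorem hyp3F2AtOneEq_sub_shift {m a b y : ℂ} (h0 : m + 1 - a ≠ 0) (ha : a - 1 ≠ 0)
    (hba : b - a + m ≠ 0) (he : ¬ IsGammaPole (a - m + 1)) (hz : ¬ IsGammaPole (a + y))
    (hw : ¬ IsGammaPole (1 + b - a - y)) (hs : ¬ IsGammaPole (2 - b + y))
    (hy : y * (m + 1 - a) = m * (b - 1)) :
    Hyp3F2AtOneEq a b (a - m - 1) (a - m + 1) (a + y)
      (Complex.sin (Real.pi * (b - a - y)) * (m - a) * (b * m - a + 1) * Complex.Gamma (a + y) *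
          Complex.Gamma (1 + b - a - y) * Complex.Gamma (2 - b + y) /
        ((b - a + m) * (a - 1) * Real.pi * Complex.Gamma (2 + y))) := by
  have h := hyp3F2AtOneEq_add_two (a := a) (b := b) (c := a - m - 1) (z := a + y)
    (by rwa [show a - m - 1 + 2 = a - m + 1 by ring]) hz
    (by rwa [show a + y + 2 - a - b = 2 - b + y by ring]) (by linear_combination -hy)
  have hpi : (Real.pi : ℂ) ≠ 0 := by exact_mod_cast Real.pi_ne_zero
  -- Reflection is applied one unit to the left of a + y + 1 - b. The extra factor b - a - y,
  -- evaluated in `h4`, cancels (b - a + m)(a - 1) in the denominator up to sign and m + 1 - a.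
  have h1 : Complex.sin (Real.pi * (b - a - y)) * Complex.Gamma (1 + b - a - y) =
      Real.pi * (b - a - y) * (Complex.Gamma (a + y + 1 - b))⁻¹ := by
    have h2 := inv_Gamma_eq_sin_mul (z := -(b - a - y))
      (by rwa [show 1 - -(b - a - y) = 1 + b - a - y by ring])
    rw [inv_Gamma_add_one, show 1 - -(b - a - y) = 1 + b - a - y by ring, mul_neg,
      Complex.sin_neg, show -(b - a - y) + 1 = a + y + 1 - b by ring, eq_div_iff hpi] at h2
    linear_combination h2
  have h3 : 1 + y = (b * m - a + 1) / (m + 1 - a) := by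
    rw [eq_div_iff h0]
    linear_combination hy
  have h4 : b - a - y = (1 - a) * (b - a + m) / (m + 1 - a) := by
    rw [eq_div_iff h0]
    linear_combination -hy
  convert h using 1
  · ring
  · rw [show a + y + 2 - a - b = 2 - b + y by ring, show a + y + 1 - a = 1 + y by ring,
      inv_Gamma_add_one (1 + y), show 1 + y + 1 = 2 + y by ring, div_eq_mul_inv, mul_inv]
    calc _ = (Complex.sin (Real.pi * (b - a - y)) * Complex.Gamma (1 + b - a - y)) *
          ((m - a) * (b * m - a + 1) * Complex.Gamma (a + y) * Complex.Gamma (2 - b + y) *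
          (((b - a + m) * (a - 1) * Real.pi)⁻¹ * (Complex.Gamma (2 + y))⁻¹)) := by ring
      _ = _ := by
        rw [h1, h3, h4]
        field_simp
        ring

end Hyp3F2

theorem mainTheorem10 (n : ℕ) (hn : 0 < n) (a b : ℂ) :
    -- (1) parametric excess 2
    ((b + n ≠ 0 ∧ Complex.sin (Real.pi * a) ≠ 0 ∧ ¬ IsGammaPole (-b) ∧
        ¬ IsGammaPole (1 + b + a * n / (b + n))) →
      HasSum (hyp3F2Term a b (-n + a * n / (b + n)) (1 + b + a * n / (b + n)) (a - n + 1))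
        ((-1) ^ n * Complex.sin (Real.pi * b) * Complex.Gamma (1 + b + a * n / (b + n)) *
            Complex.Gamma (-b) /
          (Complex.sin (Real.pi * a) * Complex.Gamma (1 + a) *
            Complex.Gamma (1 - n + a * n / (b + n)) * Complex.Gamma (n - a)))) ∧
    -- (2) parametric excess 2
    ((Complex.sin (Real.pi * a) ≠ 0 ∧ ¬ IsGammaPole (-b) ∧
        ¬ IsGammaPole (1 + b + a * n / (-b + n))) →
      HasSum (hyp3F2Term a b (-(n * (n - b + a) / (b - n))) (1 + b - a * n / (b - n)) (1 + a + n))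
        ((-1) ^ n * Complex.sin (Real.pi * b) * Complex.Gamma (1 + b + a * n / (-b + n)) *
            Complex.Gamma (-b) /
          (Complex.sin (Real.pi * a) * Complex.Gamma (1 + a) * Complex.Gamma (-a - n) *
            Complex.Gamma (n + 1 + a * n / (-b + n))))) ∧
    -- (3) parametric excess 2 - b + n (b - 1) / (n + 1 - a)
    ((n + 1 - a ≠ 0 ∧ a - 1 ≠ 0 ∧ b - a + n ≠ 0 ∧ ¬ IsGammaPole (a - n + 1) ∧
        ¬ IsGammaPole (a + n * (b - 1) / (n + 1 - a)) ∧
        ¬ IsGammaPole (2 - a + (-a + 1) * (b - 1) / (n + 1 - a)) ∧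
        ¬ IsGammaPole (2 - b + n * (b - 1) / (n + 1 - a))) →
      Hyp3F2AtOneEq a b (a - n - 1) (a - n + 1) (a - n * (b - 1) / (a - n - 1))
        (Complex.sin (Real.pi * (b - a + n * (-b + 1) / (n + 1 - a))) * (n - a) *
            (b * n - a + 1) * Complex.Gamma (a + n * (b - 1) / (n + 1 - a)) *
            Complex.Gamma (2 - a + (-a + 1) * (b - 1) / (n + 1 - a)) *
            Complex.Gamma (2 - b + n * (b - 1) / (n + 1 - a)) /
          ((b - a + n) * (a - 1) * Real.pi *
            Complex.Gamma (2 + n * (b - 1) / (n + 1 - a))))) ∧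
    -- (4) parametric excess n + 1
    ((¬ IsGammaPole (2 + (b - 1) * (-a + 1) / n) ∧ ¬ IsGammaPole (-a - n + 1) ∧
        ¬ IsGammaPole (-1 + a + b + n)) →
      HasSum (hyp3F2Term a b (-((a - 1) * (b - 1) / n)) (2 + (b - 1) * (-a + 1) / n)
          (-1 + a + b + n))
        (Complex.sin (Real.pi * a) * (-1) ^ n * (n - a * b + a + b - 1) * Complex.Gamma n *
            Complex.Gamma (-a - n + 1) * Complex.Gamma (-1 + a + b + n) /
          (Real.pi * Complex.Gamma (b + n)))) ∧
    -- (5) parametric excess 2 - b - n (1 - b) / (b - a - 1)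
    ((1 + a - b ≠ 0 ∧ Complex.sin (Real.pi * a) ≠ 0 ∧
        ¬ IsGammaPole (2 - b - n * (-b + 1) / (b - a - 1)) ∧
        ¬ IsGammaPole (n * (b - 1) / (1 + a - b))) →
      Hyp3F2AtOneEq a b (1 + a + a * n / (1 + a - b)) (2 + a) (1 + a + n)
        (-(Complex.sin (Real.pi * n * a / (1 + a - b)) * (1 + a) *
            Complex.Gamma (2 - b - n * (-b + 1) / (b - a - 1)) *
            Complex.Gamma (n * (b - 1) / (1 + a - b)) /
          (Complex.sin (Real.pi * a) * Complex.Gamma (-b + a + 2 + n) *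
            Complex.Gamma (-a - n))))) ∧
    -- (6) parametric excess 1 + (b - 1) (1 - a) / (a + n - 1)
    ((a + n - 1 ≠ 0 ∧ a - 1 ≠ 0 ∧ n - b + a ≠ 0 ∧ ¬ IsGammaPole (1 + a + n) ∧
        ¬ IsGammaPole (1 + (b - 1) * (-a + 1) / (a + n - 1)) ∧
        ¬ IsGammaPole (a + n * (b - 1) / (a + n - 1)) ∧
        ¬ IsGammaPole (2 - a + (b - 1) * (a - 1) / (a + n - 1))) →
      Hyp3F2AtOneEq a b (a + n - 1) (1 + a + n) (a - 1 + (b * n + a - 1) / (a + n - 1))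
        (-(Complex.sin (Real.pi * (a + (-b + 1) * (a - 1) / (a + n - 1))) *
            (b * n + a - 1) * (a + n) *
            Complex.Gamma (1 + (b - 1) * (-a + 1) / (a + n - 1)) *
            Complex.Gamma (a + n * (b - 1) / (a + n - 1)) *
            Complex.Gamma (2 - a + (b - 1) * (a - 1) / (a + n - 1)) /
          ((n - b + a) * Real.pi * (a - 1) *
            Complex.Gamma ((b * n + a - 1) / (a + n - 1) + 1))))) ∧
    -- (7) parametric excess 2 - b + n (b - 1) / (1 + a - b)
    ((1 + a - b ≠ 0 ∧ Complex.sin (Real.pi * a) ≠ 0 ∧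
        ¬ IsGammaPole (2 - b + n * (b - 1) / (1 + a - b)) ∧
        ¬ IsGammaPole (-(n * (b - 1) / (1 + a - b)))) →
      Hyp3F2AtOneEq a b (1 + a - a * n / (1 + a - b)) (2 + a) (a - n + 1)
        ((1 + a) * Complex.sin (Real.pi * a * n / (1 + a - b)) *
            Complex.Gamma (2 - b + n * (b - 1) / (1 + a - b)) *
            Complex.Gamma (-(n * (b - 1) / (1 + a - b))) /
          (Complex.sin (Real.pi * a) * Complex.Gamma (-b + a + 2 - n) *
            Complex.Gamma (n - a)))) := by
  refine ⟨?_, ?_, ?_, ?_, ?_, ?_, ?_⟩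
  · rintro ⟨h0, ha, hb, he⟩
    have h := hasSum_excess_two_shift (m := n) (x := a * n / (b + n)) (Or.inl rfl) ha hb he
      (div_mul_cancel₀ _ h0)
    rwa [sub_eq_neg_add] at h
  · rintro ⟨ha, hb, he⟩
    -- The case b = n is already excluded, since -b would be a pole of Γ.
    have h0 : -b + (n : ℂ) ≠ 0 := add_natCast_ne_zero hb n
    have h1 : b - n ≠ 0 := fun h => h0 (by linear_combination -h)
    have h := hasSum_excess_two_shift (m := -n) (x := a * n / (-b + n)) (Or.inr rfl) ha hb he
      (by field_simp; ring)
    convert h using 1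
    · congr 1
      · field_simp
        ring
      · rw [sub_eq_add_neg, ← div_neg, neg_sub, sub_eq_neg_add]
      · ring
    · rw [sub_neg_eq_add, add_comm (1 : ℂ) (n : ℂ), show -(n : ℂ) - a = -a - n by ring,
        mul_right_comm (Complex.sin _ * Complex.Gamma _)]
  · rintro ⟨h0, ha, hba, he, hz, hw, hs⟩
    have h2 : (2 : ℂ) - a + (-a + 1) * (b - 1) / (n + 1 - a) =
        1 + b - a - n * (b - 1) / (n + 1 - a) := by
      field_simp
      ring
    rw [h2] at hw
    have h := hyp3F2AtOneEq_sub_shift h0 ha hba he hz hw hs (div_mul_cancel₀ _ h0)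
    rw [h2, show a - n * (b - 1) / (a - n - 1) = a + n * (b - 1) / (n + 1 - a) by
      rw [sub_eq_add_neg, ← div_neg, neg_sub, sub_sub_eq_add_sub, add_comm (1 : ℂ)],
      show b - a + n * (-b + 1) / (n + 1 - a) = b - a - n * (b - 1) / (n + 1 - a) by ring]
    exact h
  · rintro ⟨he, h1, hz⟩
    have hn0 : (n : ℂ) ≠ 0 := by exact_mod_cast hn.ne'
    have hn1 : -1 + a + b + n + 2 - a - b = (n : ℂ) + 1 := by ring
    have hpos : 0 < ((n : ℂ) + 1).re := by
      simp only [Complex.add_re, Complex.natCast_re, Complex.one_re]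
      positivity
    have hc : 2 + (b - 1) * (-a + 1) / (n : ℂ) = -((a - 1) * (b - 1) / n) + 2 := by ring
    rw [hc] at he ⊢
    -- The excess is n + 1, so the continued value is the sum of the series.
    have h := (hyp3F2AtOneEq_add_two he hz (by rw [hn1]; exact not_isGammaPole_of_re_pos hpos)
      (by field_simp; ring)).hasSum (by
        rwa [show -((a - 1) * (b - 1) / n) + 2 + (-1 + a + b + n) - a - b -
          -((a - 1) * (b - 1) / n) = (n : ℂ) + 1 by ring])
    have hg := inv_Gamma_eq_sin_mul (z := a + n) (by rwa [show 1 - (a + n) = -a - n + 1 by ring])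
    have hsin := sin_pi_mul_sub (n := n) (m := -n) (Or.inr rfl) a
    rw [sub_neg_eq_add] at hsin
    rw [hsin, show 1 - (a + n) = -a - n + 1 by ring] at hg
    have hpi : (Real.pi : ℂ) ≠ 0 := by exact_mod_cast Real.pi_ne_zero
    convert h using 1
    rw [hn1, Complex.Gamma_add_one _ hn0, show -1 + a + b + n + 1 - a = b + n by ring,
      show -1 + a + b + n + 1 - b = a + n by ring, hg]
    field_simp
    ring
  · rintro ⟨h0, ha, hs, hxm⟩
    have h1 : b - a - 1 ≠ 0 := fun h => h0 (by linear_combination -h)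
    have h2 : n * (b - 1) / (1 + a - b) = a * n / (1 + a - b) - n := by
      field_simp
      ring
    have h3 : 2 - b - n * (-b + 1) / (b - a - 1) = 2 - b + (n - a * n / (1 + a - b)) := by
      rw [show b - a - 1 = -(1 + a - b) by ring, div_neg]
      linear_combination -h2
    rw [h2] at hxm ⊢
    rw [h3] at hs ⊢
    rw [show Real.pi * n * a / (1 + a - b) = Real.pi * (a * n / (1 + a - b)) by ring]
    exact hyp3F2AtOneEq_int_shift (Or.inl rfl) ha hs hxm (div_mul_cancel₀ _ h0)
  · rintro ⟨h0, ha, hba, he, hs, hz, hw⟩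
    obtain ⟨y, hy⟩ : ∃ y, y = n * (b - 1) / (a + n - 1) := ⟨_, rfl⟩
    have h1 : 1 + (b - 1) * (-a + 1) / (a + n - 1) = 2 - b + y := by
      rw [hy]
      field_simp
      ring
    have h2 : (b * n + a - 1) / (a + n - 1) = 1 + y := by
      rw [hy]
      field_simp
      ring
    have h3 : 2 - a + (b - 1) * (a - 1) / (a + n - 1) = 1 + b - a - y := by
      rw [hy]
      field_simp
      ring
    -- The stated sine has the complementary argument; sin(π(1 - x)) = sin(πx) reconciles the two
    -- forms.
    have h4 : a + (-b + 1) * (a - 1) / (a + n - 1) = 1 - (b - a - y) := by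
      linear_combination -h3
    rw [h1] at hs
    rw [h3] at hw
    rw [← hy] at hz
    have h := hyp3F2AtOneEq_sub_shift (m := -n) (y := y) (b := b)
      (fun h => h0 (by linear_combination -h)) ha (fun h => hba (by linear_combination -h))
      (by rwa [show a - -n + 1 = 1 + a + (n : ℂ) by ring]) hz hw hs
      (by rw [hy]; field_simp; ring)
    rw [← hy, h1, h2, h3, h4, sin_pi_mul_one_sub]
    convert h using 1
    · ring
    · ring
    · ring
    · rw [show b - a + -(n : ℂ) = -(n - b + a) by ring, show 1 + y + 1 = 2 + y by ring]
      field_simp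
      ring
  · rintro ⟨h0, ha, hs, hxm⟩
    have h2 : -(n * (b - 1) / (1 + a - b)) = -(a * n / (1 + a - b)) - -n := by
      field_simp
      ring
    have h3 : 2 - b + n * (b - 1) / (1 + a - b) = 2 - b + (-n - -(a * n / (1 + a - b))) := by
      linear_combination -h2
    rw [h2] at hxm ⊢
    rw [h3] at hs ⊢
    have h := hyp3F2AtOneEq_int_shift (n := n) (Or.inr rfl) ha hs hxm
      (by rw [neg_mul, div_mul_cancel₀ _ h0, mul_neg])
    rw [show Real.pi * a * n / (1 + a - b) = Real.pi * (a * n / (1 + a - b)) by ring]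
    convert h using 1
    · ring
    · ring
    · rw [mul_neg, Complex.sin_neg, sub_eq_add_neg _ (n : ℂ), show -a - -(n : ℂ) = n - a by ring]
      ring
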